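/- Let $k\ge 3$ be an integer and let $\underline n=(n_1,\dots,n_k)$ be a tuple of integers with $n_i\ge 2$ for all $i$, not necessarily ordered, such that $n_i$ is even for at least one $i$. Let $\mathcal G_{\underline n}$ be the knight graph of the $n_1\times\cdots\times n_k$ chessboard: its vertices are the integer points of $\mathcal B_{\underline n}=\{1,\dots,n_1\}\times\cdots\times\{1,\dots,n_k\}$, and two vertices $a,b$ are joined by an edge if and only if $a-b\in\mathbb Z^k$ has exactly one coordinate in $\{1,-1\}$, exactly one coordinate in $\{2,-2\}$, and all other $k-2$ coordinates equal to $0$. A closed knight tour on $\mathcal B_{\underline n}$ is a Hamiltonian cycle of $\mathcal G_{\underline n}$. Then $\mathcal B_{\underline n}$ has a closed knight tour if and only if $\mathcal G_{\underline n}$ is connected. -/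

import Mathlib

namespace KnightTour

/-- The board `⟦1, n₁⟧ × ⋯ × ⟦1, n_k⟧`, as a set of integer points. -/
abbrev Board {k : ℕ} (n : Fin k → ℕ) : Type :=
  {a : Fin k → ℤ // ∀ i, 1 ≤ a i ∧ a i ≤ (n i : ℤ)}

/-- The knight moves in dimension `k`: integer vectors with one entry in `{1, -1}`,
one entry in `{2, -2}`, and all the other `k - 2` entries equal to `0`. -/
def moves (k : ℕ) : Set (Fin k → ℤ) :=
  {c | (Finset.univ.filter fun i => c i = 0).card + 2 = k ∧
    (Finset.univ.filter fun i => c i = 1 ∨ c i = -1).card = 1 ∧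
    (Finset.univ.filter fun i => c i = 2 ∨ c i = -2).card = 1}

theorem neg_mem_moves {k : ℕ} {c : Fin k → ℤ} (hc : c ∈ moves k) : -c ∈ moves k := by
  obtain ⟨h0, h1, h2⟩ := hc
  refine ⟨?_, ?_, ?_⟩
  · simpa using h0
  · simpa [neg_eq_iff_eq_neg, or_comm] using h1
  · simpa [neg_eq_iff_eq_neg, or_comm] using h2

/-- The knight graph of the board: two squares are adjacent if and only if they differ by
a knight move. -/
def knightGraph {k : ℕ} (n : Fin k → ℕ) : SimpleGraph (Board n) where
  Adj a b := a.1 - b.1 ∈ moves k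
  symm := ⟨fun a b h => by simpa using neg_mem_moves h⟩
  loopless := ⟨fun a h => by simpa [moves] using h.2.1⟩

/-- A closed knight tour is a Hamiltonian cycle of the knight graph. -/
def HasClosedTour {k : ℕ} (n : Fin k → ℕ) : Prop :=
  ∃ (a : Board n) (p : (knightGraph n).Walk a a), p.IsHamiltonianCycle

end KnightTour

/-!
A closed tour makes the graph connected, so the content lies in the converse. Connectedness is used
only through two inequalities: some side is at least `4` (`exists_four_le`), as otherwise the point
`(2, …, 2)` is isolated, and at least two sides are at least `3` (`exists_three_le`), as otherwise
all moves preserve the parity of one coordinate. With an even side available, one can then choose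
three coordinates (`exists_coordinates`) whose sides `a`, `b`, `c` satisfy: `c` is even, and either
`a ≥ 3` and `b ≥ 4`, or `a = b = 3` and `c ≥ 4`. It remains to construct a tour.

All constructions rest on one operation (`Tour.merge`, `Tour.glue`): if `pq` is an edge of a tour of
`S`, `rs` an edge of a tour of a set `T` disjoint from `S`, and `pr` and `qs` are knight moves, then
replacing `pq` and `rs` by `pr` and `qs` yields a tour of `S ∪ T`. To be able to repeat the
operation, one carries along a list of edges which the tours contain in prescribed places.

In dimension three (`tour_box`), explicit tours of the slabs `x × y × 2` with `3 ≤ x ≤ 5` and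
`4 ≤ y ≤ 7` are extended by steps of `3` in the first and of `4` in the second direction, and the
resulting slabs are stacked to any even height. The boxes `3 × 3 × c` are stacked from explicit
tours of those of heights `4` and `6`. The resulting tours contain two disjoint pairs of parallel
edges, that is, of edges whose ends differ by `±2` in one coordinate.

Such a pair is what is needed to connect copies of a tour in successive layers of a board with one
more dimension, because `±2` in one coordinate together with `1` in the new one is a knight move.
The copies of the other pair in the first and the last layer are two such pairs in the new tour, so
that any number of dimensions can be added (`HasPairedTour.update`). Formally, the dimension is
fixed, and a side of length `1` is increased.
-/

namespace KnightTour

/-! ### Closed tours as cyclic lists -/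

section

variable {V W : Type*}

/-- The edges traversed by a path, given as the list of its successive vertices. -/
def pathEdges : List V → List (Sym2 V)
  | a :: b :: l => s(a, b) :: pathEdges (b :: l)
  | _ => []

/-- The edges traversed by a closed path which visits the vertices of a list in order and then
returns from the last one to the first one. -/
def cycleEdges : List V → List (Sym2 V)
  | [] => []
  | a :: l => pathEdges (a :: (l ++ [a]))

theorem pathEdges_append (l : List V) (a : V) (m : List V) :
    pathEdges (l ++ a :: m) = pathEdges (l ++ [a]) ++ pathEdges (a :: m) := by
  induction l with
  | nil => simp [pathEdges]
  | cons b l ih => cases l <;> simp_all [pathEdges]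

theorem pathEdges_reverse (l : List V) : pathEdges l.reverse = (pathEdges l).reverse := by
  induction l with
  | nil => rfl
  | cons a l ih =>
    cases l with
    | nil => rfl
    | cons b l =>
      rw [List.reverse_cons, List.reverse_cons, List.append_assoc, List.singleton_append,
        pathEdges_append, ← List.reverse_cons, ih]
      simp [pathEdges, Sym2.eq_swap]

theorem pathEdges_map (f : V → W) (l : List V) :
    pathEdges (l.map f) = (pathEdges l).map (Sym2.map f) := by
  induction l with
  | nil => rfl
  | cons a l ih => cases l <;> simp_all [pathEdges]

theorem mem_pathEdges {l : List V} {e : Sym2 V} (h : e ∈ pathEdges l) :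
    ∃ l₁ a b l₂, l = l₁ ++ a :: b :: l₂ ∧ e = s(a, b) := by
  induction l with
  | nil => simp [pathEdges] at h
  | cons a l ih =>
    cases l with
    | nil => simp [pathEdges] at h
    | cons b l =>
      rw [pathEdges, List.mem_cons] at h
      obtain h | h := h
      · exact ⟨[], a, b, l, rfl, h⟩
      · obtain ⟨l₁, c, d, l₂, hl, he⟩ := ih h
        exact ⟨a :: l₁, c, d, l₂, by rw [hl]; rfl, he⟩

theorem isChain_of_pathEdges {G : SimpleGraph V} {l : List V}
    (h : ∀ e ∈ pathEdges l, e ∈ G.edgeSet) : l.IsChain G.Adj := by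
  induction l with
  | nil => simp
  | cons a l ih => cases l <;> simp_all [pathEdges]

theorem cycleEdges_append (l m : List V) :
    (cycleEdges (l ++ m)).Perm (cycleEdges (m ++ l)) := by
  cases l with
  | nil => simp
  | cons a l =>
    cases m with
    | nil => simp
    | cons b m =>
      have h (a b : V) (l m : List V) : cycleEdges (a :: l ++ b :: m) =
          pathEdges (a :: l ++ [b]) ++ pathEdges (b :: m ++ [a]) := by
        simpa [cycleEdges] using pathEdges_append (a :: l) b (m ++ [a])
      rw [h, h]
      exact List.perm_append_comm

theorem cycleEdges_reverse (l : List V) : (cycleEdges l.reverse).Perm (cycleEdges l) := by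
  cases l with
  | nil => rfl
  | cons a l =>
    rw [List.reverse_cons]
    refine (cycleEdges_append _ _).trans ?_
    have h : a :: (l.reverse ++ [a]) = (a :: (l ++ [a])).reverse := by simp
    rw [List.singleton_append, cycleEdges, cycleEdges, h, pathEdges_reverse]
    exact List.reverse_perm _

theorem cycleEdges_map (f : V → W) (l : List V) :
    cycleEdges (l.map f) = (cycleEdges l).map (Sym2.map f) := by
  cases l with
  | nil => rfl
  | cons a l => simp [cycleEdges, ← pathEdges_map]

theorem cycleEdges_concat (a : V) (l : List V) (b : V) :
    cycleEdges (a :: (l ++ [b])) = pathEdges (a :: (l ++ [b])) ++ [s(b, a)] := by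
  have h := pathEdges_append (a :: l) b [a]
  simpa [cycleEdges, pathEdges] using h

theorem cycleEdges_merge (q : V) (l : List V) (p r : V) (m : List V) (s : V) :
    cycleEdges (q :: (l ++ [p]) ++ r :: (m ++ [s])) =
      pathEdges (q :: (l ++ [p])) ++ s(p, r) :: (pathEdges (r :: (m ++ [s])) ++ [s(s, q)]) := by
  have h₁ := pathEdges_append (q :: l) p (r :: (m ++ [s, q]))
  have h₂ := pathEdges_append (r :: m) s [q]
  simp_all [cycleEdges, pathEdges]

theorem mem_of_mem_cycleEdges {l : List V} {p q : V} (h : s(p, q) ∈ cycleEdges l) : p ∈ l := by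
  cases l with
  | nil => simp [cycleEdges] at h
  | cons a l =>
    obtain ⟨l₁, x, y, l₂, hl, he⟩ := mem_pathEdges h
    have hp : p ∈ l₁ ++ x :: y :: l₂ := by
      rcases Sym2.eq_iff.1 he with ⟨rfl, rfl⟩ | ⟨rfl, rfl⟩ <;> simp
    rw [← hl] at hp
    simp only [List.mem_cons, List.mem_append, List.not_mem_nil, or_false] at hp ⊢
    tauto

/-- A cyclic list can be cut open at any of its edges, in either of the two directions. -/
theorem exists_cut {l : List V} {p q : V} (h : s(p, q) ∈ cycleEdges l) (hpq : p ≠ q) :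
    ∃ m, (q :: (m ++ [p])).Perm l ∧ (cycleEdges (q :: (m ++ [p]))).Perm (cycleEdges l) := by
  have key : ∃ x y m, s(p, q) = s(x, y) ∧ (y :: (m ++ [x])).Perm l ∧
      (cycleEdges (y :: (m ++ [x]))).Perm (cycleEdges l) := by
    cases l with
    | nil => simp [cycleEdges] at h
    | cons a l =>
      obtain ⟨l₁, x, y, l₂, hl, he⟩ := mem_pathEdges h
      obtain rfl | ⟨l₃, b, rfl⟩ := l₂.eq_nil_or_concat
      · obtain ⟨hl', rfl⟩ : a :: l = l₁ ++ [x] ∧ a = y := by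
          have : (a :: l) ++ [a] = (l₁ ++ [x]) ++ [y] := by simpa using hl
          simpa using List.append_inj' this rfl
        cases l₁ with
        | nil =>
          obtain ⟨rfl, rfl⟩ : a = x ∧ l = [] := by simpa using hl'
          exact absurd he (by simpa [Sym2.eq_iff] using fun h h' => hpq (h.trans h'.symm))
        | cons c l₁ =>
          obtain ⟨rfl, rfl⟩ : a = c ∧ l = l₁ ++ [x] := by simpa using hl'
          exact ⟨x, a, l₁, he, .refl _, .refl _⟩
      · obtain ⟨hl', rfl⟩ : a :: l = (l₁ ++ [x]) ++ (y :: l₃) ∧ a = b := by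
          have : (a :: l) ++ [a] = ((l₁ ++ [x]) ++ (y :: l₃)) ++ [b] := by simpa using hl
          simpa using List.append_inj' this rfl
        refine ⟨x, y, l₃ ++ l₁, he, ?_, ?_⟩
        · rw [hl']
          simpa using List.perm_append_comm (l₁ := y :: l₃) (l₂ := l₁ ++ [x])
        · rw [hl']
          simpa using cycleEdges_append (y :: l₃) (l₁ ++ [x])
  obtain ⟨x, y, m, he, h₁, h₂⟩ := key
  rcases Sym2.eq_iff.1 he with ⟨rfl, rfl⟩ | ⟨rfl, rfl⟩
  · exact ⟨m, h₁, h₂⟩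
  · have hr : q :: (m.reverse ++ [p]) = (p :: (m ++ [q])).reverse := by simp
    exact ⟨m.reverse, hr ▸ (List.reverse_perm _).trans h₁,
      hr ▸ (cycleEdges_reverse _).trans h₂⟩

/-- `Tour G S E` says that the vertices in `S` can be arranged in a cyclic list, without
repetitions, whose successive members are adjacent in `G`, and that every pair in `E` is an edge
of this closed tour of `S`. -/
def Tour (G : SimpleGraph V) (S : Set V) (E : Set (Sym2 V)) : Prop :=
  ∃ l : List V, l.Nodup ∧ (∀ v, v ∈ l ↔ v ∈ S) ∧ (∀ e ∈ cycleEdges l, e ∈ G.edgeSet) ∧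
    ∀ e ∈ E, e ∈ cycleEdges l

namespace Tour

variable {G : SimpleGraph V} {H : SimpleGraph W} {S T : Set V} {E F : Set (Sym2 V)}

theorem mono (h : Tour G S E) (hF : F ⊆ E) : Tour G S F := by
  obtain ⟨l, h₁, h₂, h₃, h₄⟩ := h
  exact ⟨l, h₁, h₂, h₃, fun e he => h₄ e (hF he)⟩

theorem map (h : Tour G S E) (f : V → W) (hf : Function.Injective f)
    (hadj : ∀ a b, G.Adj a b → H.Adj (f a) (f b)) :
    Tour H (f '' S) (Sym2.map f '' E) := by
  obtain ⟨l, h₁, h₂, h₃, h₄⟩ := h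
  refine ⟨l.map f, h₁.map hf, by simp [h₂], ?_, ?_⟩
  · rw [cycleEdges_map]
    simp only [List.mem_map]
    rintro _ ⟨e, he, rfl⟩
    induction e with
    | h x y => exact hadj _ _ (h₃ _ he)
  · rw [cycleEdges_map]
    rintro _ ⟨e, he, rfl⟩
    exact List.mem_map_of_mem (h₄ e he)

theorem left_mem {p q : V} (h : Tour G S E) (he : s(p, q) ∈ E) : p ∈ S := by
  obtain ⟨l, -, h₂, -, h₄⟩ := h
  exact (h₂ p).1 (mem_of_mem_cycleEdges (h₄ _ he))

theorem right_mem {p q : V} (h : Tour G S E) (he : s(p, q) ∈ E) : q ∈ S :=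
  h.left_mem (Sym2.eq_swap ▸ he)

/-- Two tours of disjoint sets with edges `pq` and `rs` such that `pr` and `qs` are edges of the
graph merge into a tour of the union: replace `pq` and `rs` by `pr` and `qs`. -/
theorem merge {p q r s : V} (h : Tour G S E) (h' : Tour G T F) (hST : Disjoint S T)
    (hpq : s(p, q) ∈ E) (hrs : s(r, s) ∈ F) (hpr : G.Adj p r) (hqs : G.Adj q s) :
    Tour G (S ∪ T) (E \ {s(p, q)} ∪ F \ {s(r, s)}) := by
  obtain ⟨l, h₁, h₂, h₃, h₄⟩ := h
  obtain ⟨l', h₁', h₂', h₃', h₄'⟩ := h'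
  obtain ⟨m, hm, hm'⟩ := exists_cut (h₄ _ hpq) (G.ne_of_adj (h₃ _ (h₄ _ hpq)))
  have hrs' : s(s, r) ∈ F := Sym2.eq_swap ▸ hrs
  obtain ⟨k, hk, hk'⟩ := exists_cut (h₄' _ hrs') (G.ne_of_adj (h₃' _ (h₄' _ hrs')))
  rw [cycleEdges_concat] at hm' hk'
  have memE : ∀ e, e ∈ cycleEdges l ↔ e ∈ pathEdges (q :: (m ++ [p])) ∨ e = s(p, q) :=
    fun e => by rw [← hm'.mem_iff]; simp
  have memF : ∀ e, e ∈ cycleEdges l' ↔ e ∈ pathEdges (r :: (k ++ [s])) ∨ e = s(r, s) :=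
    fun e => by rw [← hk'.mem_iff, Sym2.eq_swap (a := r)]; simp
  refine ⟨q :: (m ++ [p]) ++ r :: (k ++ [s]), ?_, ?_, ?_, ?_⟩
  · refine (hm.nodup_iff.2 h₁).append (hk.nodup_iff.2 h₁') fun v hv hv' => ?_
    exact Set.disjoint_left.1 hST ((h₂ v).1 (hm.mem_iff.1 hv)) ((h₂' v).1 (hk.mem_iff.1 hv'))
  · intro v
    rw [List.mem_append, hm.mem_iff, hk.mem_iff, h₂, h₂', Set.mem_union]
  · intro e he
    rw [cycleEdges_merge] at he
    simp only [List.mem_append, List.mem_cons, List.not_mem_nil, or_false] at he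
    obtain he | rfl | he | rfl := he
    · exact h₃ e ((memE e).2 (.inl he))
    · exact hpr
    · exact h₃' e ((memF e).2 (.inl he))
    · exact hqs.symm
  · intro e he
    rw [cycleEdges_merge]
    simp only [List.mem_append, List.mem_cons, List.not_mem_nil, or_false]
    obtain ⟨he, hne⟩ | ⟨he, hne⟩ := he
    · exact .inl (((memE e).1 (h₄ e he)).resolve_right hne)
    · exact .inr (.inr (.inl (((memF e).1 (h₄' e he)).resolve_right hne)))

end Tour

end

/-! ### Gluing translated tours -/

/-- Gluing a tour of `S` and a translated tour of `T` along the edges `pq` and `rs`; the edges of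
either tour other than these two survive. -/
theorem Tour.glue {V : Type*} [AddCommGroup V] {G : SimpleGraph V}
    (hG : ∀ a b t, G.Adj a b → G.Adj (a + t) (b + t)) {S T U : Set V} {E F E' : Set (Sym2 V)}
    (h : Tour G S E) (h' : Tour G T F) (t : V) {p q r s : V}
    (hpq : s(p, q) ∈ E) (hrs : s(r, s) ∈ F) (hpr : G.Adj p (r + t)) (hqs : G.Adj q (s + t))
    (hU : ∀ v, v ∈ U ↔ v ∈ S ∨ v - t ∈ T) (hST : ∀ v ∈ S, v - t ∉ T)
    (hE' : ∀ e ∈ E', (e ∈ E ∧ e ≠ s(p, q)) ∨ ∃ f ∈ F, f ≠ s(r, s) ∧ Sym2.map (· + t) f = e) :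
    Tour G U E' := by
  have hinj : Function.Injective fun v : V => v + t := add_left_injective t
  have hmem (v : V) : v ∈ (fun v => v + t) '' T ↔ v - t ∈ T :=
    ⟨by rintro ⟨w, hw, rfl⟩; simpa using hw, fun hv => ⟨v - t, hv, by simp⟩⟩
  have key := h.merge (h'.map (H := G) (· + t) hinj fun a b => hG a b t)
    (Set.disjoint_left.2 fun v hv hv' => hST v hv ((hmem v).1 hv')) hpq
    (Set.mem_image_of_mem _ hrs) hpr hqs
  have hSU : S ∪ (fun v => v + t) '' T = U := by
    ext v
    rw [Set.mem_union, hmem, hU]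
  rw [hSU] at key
  refine key.mono fun e he => ?_
  obtain ⟨h₁, h₂⟩ | ⟨f, hf, hne, rfl⟩ := hE' e he
  · exact .inl ⟨h₁, h₂⟩
  · refine .inr ⟨Set.mem_image_of_mem _ hf, fun hf' => hne ?_⟩
    exact Sym2.map.injective hinj hf'

/-! ### Knight moves in space -/

/-- The knight graph on all integer points of space. A vector of `ℤ³` is a knight move if and only
if its squared length is `5`. -/
def spaceGraph : SimpleGraph (ℤ × ℤ × ℤ) where
  Adj a b := (a.1 - b.1) ^ 2 + (a.2.1 - b.2.1) ^ 2 + (a.2.2 - b.2.2) ^ 2 = 5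
  symm := ⟨fun a b h => by rw [← h]; ring⟩
  loopless := ⟨fun a h => by simp at h⟩

theorem spaceGraph_adj {a b : ℤ × ℤ × ℤ} : spaceGraph.Adj a b ↔
    (a.1 - b.1) ^ 2 + (a.2.1 - b.2.1) ^ 2 + (a.2.2 - b.2.2) ^ 2 = 5 :=
  Iff.rfl

instance : DecidableRel spaceGraph.Adj := fun _ _ => decidable_of_iff _ spaceGraph_adj.symm

theorem spaceGraph_adj_add (a b t : ℤ × ℤ × ℤ) (h : spaceGraph.Adj a b) :
    spaceGraph.Adj (a + t) (b + t) := by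
  simpa [spaceGraph_adj] using h

/-- The box `⟦1, a⟧ × ⟦1, b⟧ × ⟦1, c⟧`. -/
def box (a b c : ℤ) : Set (ℤ × ℤ × ℤ) :=
  {v | (1 ≤ v.1 ∧ v.1 ≤ a) ∧ (1 ≤ v.2.1 ∧ v.2.1 ≤ b) ∧ 1 ≤ v.2.2 ∧ v.2.2 ≤ c}

theorem mem_box {a b c : ℤ} {v : ℤ × ℤ × ℤ} : v ∈ box a b c ↔
    (1 ≤ v.1 ∧ v.1 ≤ a) ∧ (1 ≤ v.2.1 ∧ v.2.1 ≤ b) ∧ 1 ≤ v.2.2 ∧ v.2.2 ≤ c :=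
  Iff.rfl

/-- The point of space with coordinates the last three decimal digits of a number. -/
def point (d : ℕ) : ℤ × ℤ × ℤ := ((d / 100 : ℕ), (d / 10 % 10 : ℕ), (d % 10 : ℕ))

/-- A criterion for tours of boxes that can be checked by evaluation. -/
theorem tour_of_points (a b c : ℕ) (E : List (Sym2 (ℤ × ℤ × ℤ))) (l : List ℕ)
    (h : (l.map point).Nodup ∧ l.length = a * b * c ∧
      (∀ v ∈ l.map point, (1 ≤ v.1 ∧ v.1 ≤ a) ∧ (1 ≤ v.2.1 ∧ v.2.1 ≤ b) ∧
        1 ≤ v.2.2 ∧ v.2.2 ≤ c) ∧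
      (∀ e ∈ cycleEdges (l.map point), e ∈ spaceGraph.edgeSet) ∧
      ∀ e ∈ E, e ∈ cycleEdges (l.map point)) :
    Tour spaceGraph (box a b c) {e | e ∈ E} := by
  obtain ⟨h₁, h₂, h₃, h₄, h₅⟩ := h
  refine ⟨l.map point, h₁, fun v => ⟨h₃ v, fun hv => ?_⟩, h₄, h₅⟩
  have hsub : (l.map point).toFinset ⊆
      Finset.Icc 1 (a : ℤ) ×ˢ Finset.Icc 1 (b : ℤ) ×ˢ Finset.Icc 1 (c : ℤ) := fun v hv => by
    simpa using h₃ v (by simpa using hv)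
  -- A list in the box without repetitions, with as many members as the box has, exhausts it.
  have heq := Finset.eq_of_subset_of_card_le hsub (by
    rw [List.toFinset_card_of_nodup h₁]
    simp [h₂, mul_assoc])
  rw [← List.mem_toFinset, heq]
  simpa [box] using hv

/-! ### The edges reserved for gluing -/

/-- Two disjoint pairs of edges, in each of which the second edge arises from the first by moving
both of its ends by `±2` along a coordinate axis. -/
def pairEdges : List (Sym2 (ℤ × ℤ × ℤ)) :=
  [s((1, 1, 2), (2, 3, 2)), s((1, 3, 2), (2, 1, 2)),
    s((1, 2, 1), (3, 2, 2)), s((3, 2, 1), (1, 2, 2))]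

/-- The edge along which a slab of height `2` with the edge `lowerEdge` can be put on top of a box of
height `z`. It lies one layer below the top. -/
def upperEdge (z : ℤ) : Sym2 (ℤ × ℤ × ℤ) := s((1, 3, z - 1), (2, 1, z - 1))

/-- The partner of `upperEdge` in the slab above. -/
def lowerEdge : Sym2 (ℤ × ℤ × ℤ) := s((1, 4, 1), (2, 2, 1))

/-- The edge along which a box can be extended in the first direction. -/
def rightEdge (x : ℤ) : Sym2 (ℤ × ℤ × ℤ) := s((x, 1, 2), (x, 3, 1))

/-- The partner of `rightEdge` in the box glued on in the first direction. -/
def leftEdge : Sym2 (ℤ × ℤ × ℤ) := s((1, 3, 2), (1, 1, 1))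

/-- The edge along which a box can be extended in the second direction. -/
def backEdge (y : ℤ) : Sym2 (ℤ × ℤ × ℤ) := s((3, y, 2), (1, y, 1))

/-- The partner of `backEdge` in the box glued on in the second direction. -/
def frontEdge : Sym2 (ℤ × ℤ × ℤ) := s((1, 1, 2), (3, 1, 1))

/-- The edges required of a tour of a slab, other than those used to extend it horizontally. -/
def coreEdges : List (Sym2 (ℤ × ℤ × ℤ)) := upperEdge 2 :: lowerEdge :: pairEdges

/-- The edges required of a tour of the slab `⟦1, x⟧ × ⟦1, y⟧ × ⟦1, 2⟧`. Only the slabs with `x = 3`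
are glued on in the first direction, and need `leftEdge` in addition. -/
def slabEdges (x y : ℤ) : List (Sym2 (ℤ × ℤ × ℤ)) :=
  rightEdge x :: backEdge y :: frontEdge :: coreEdges

/-- The edges required of a tour of the column `⟦1, 3⟧ × ⟦1, 3⟧ × ⟦1, z⟧`. Two columns can be put
on top of each other along the first two of them. -/
def columnEdges (z : ℤ) : List (Sym2 (ℤ × ℤ × ℤ)) :=
  s((3, 2, z), (1, 3, z)) :: s((1, 2, 1), (3, 3, 1)) :: pairEdges

/-! ### Tours of small boxes -/

theorem tour_slab_3_4 : Tour spaceGraph (box 3 4 2) {e | e ∈ leftEdge :: slabEdges 3 4} :=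
  tour_of_points 3 4 2 _
    [111, 132, 212, 231, 311, 112, 232, 312, 331, 211, 131, 332, 142, 341, 322, 121, 241, 222,
      342, 141, 221, 242, 122, 321]
    (by decide +kernel)

theorem tour_slab_4_4 : Tour spaceGraph (box 4 4 2) {e | e ∈ slabEdges 4 4} :=
  tour_of_points 4 4 2 _
    [111, 231, 212, 132, 342, 141, 221, 422, 441, 242, 432, 411, 331, 121, 322, 341, 142, 222,
      421, 442, 241, 431, 412, 211, 131, 321, 122, 332, 311, 112, 232, 312]
    (by decide +kernel)

theorem tour_slab_5_4 : Tour spaceGraph (box 5 4 2) {e | e ∈ slabEdges 5 4} :=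
  tour_of_points 5 4 2 _
    [111, 231, 441, 242, 322, 121, 311, 112, 232, 422, 542, 521, 331, 132, 212, 411, 221, 141,
      342, 541, 421, 341, 142, 222, 432, 512, 531, 321, 122, 332, 131, 211, 412, 532, 511,
      431, 241, 442, 522, 312]
    (by decide +kernel)

theorem tour_slab_3_5 : Tour spaceGraph (box 3 5 2) {e | e ∈ leftEdge :: slabEdges 3 5} :=
  tour_of_points 3 5 2 _
    [111, 132, 212, 332, 252, 231, 151, 352, 142, 341, 221, 141, 351, 152, 342, 222, 241, 321,
      122, 242, 322, 121, 311, 112, 232, 251, 131, 211, 331, 312]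
    (by decide +kernel)

theorem tour_slab_4_5 : Tour spaceGraph (box 4 5 2) {e | e ∈ slabEdges 4 5} :=
  tour_of_points 4 5 2 _
    [111, 312, 331, 132, 212, 411, 432, 242, 452, 251, 131, 211, 412, 431, 241, 451, 252, 442,
      322, 121, 311, 112, 232, 352, 151, 341, 142, 222, 421, 231, 441, 422, 221, 141, 342,
      152, 351, 332, 122, 321]
    (by decide +kernel)

theorem tour_slab_5_5 : Tour spaceGraph (box 5 5 2) {e | e ∈ slabEdges 5 5} :=
  tour_of_points 5 5 2 _
    [111, 312, 522, 442, 241, 451, 252, 231, 212, 132, 151, 352, 142, 222, 412, 532, 511, 431,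
      551, 341, 131, 211, 421, 541, 331, 121, 322, 242, 452, 251, 441, 521, 542, 422, 342,
      141, 221, 411, 531, 512, 432, 552, 351, 152, 232, 112, 311, 332, 122, 321]
    (by decide +kernel)

theorem tour_slab_3_6 : Tour spaceGraph (box 3 6 2) {e | e ∈ leftEdge :: slabEdges 3 6} :=
  tour_of_points 3 6 2 _
    [111, 132, 212, 231, 252, 332, 351, 152, 362, 161, 241, 262, 342, 222, 142, 352, 151, 361,
      162, 242, 261, 141, 221, 341, 322, 121, 311, 112, 232, 251, 131, 211, 331, 312, 122,
      321]
    (by decide +kernel)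

theorem tour_slab_4_6 : Tour spaceGraph (box 4 6 2) {e | e ∈ slabEdges 4 6} :=
  tour_of_points 4 6 2 _
    [111, 132, 212, 332, 452, 251, 461, 262, 142, 352, 151, 231, 421, 222, 412, 431, 311, 112,
      232, 211, 131, 152, 351, 161, 362, 341, 322, 121, 331, 411, 221, 141, 122, 321, 441,
      422, 342, 361, 162, 242, 261, 462, 252, 442, 241, 451, 432, 312]
    (by decide +kernel)

theorem tour_slab_5_6 : Tour spaceGraph (box 5 6 2) {e | e ∈ slabEdges 5 6} :=
  tour_of_points 5 6 2 _
    [111, 132, 212, 231, 432, 411, 221, 141, 261, 242, 162, 361, 562, 352, 151, 341, 421, 541,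
      522, 332, 122, 321, 241, 222, 412, 211, 131, 152, 232, 112, 311, 512, 531, 552, 342,
      462, 441, 422, 542, 521, 322, 121, 331, 451, 252, 442, 461, 251, 452, 262, 142, 161,
      362, 561, 351, 431, 551, 532, 511, 312]
    (by decide +kernel)

theorem tour_slab_3_7 : Tour spaceGraph (box 3 7 2) {e | e ∈ leftEdge :: slabEdges 3 7} :=
  tour_of_points 3 7 2 _
    [111, 132, 212, 231, 351, 271, 151, 352, 272, 152, 171, 372, 162, 361, 342, 262, 142, 222,
      241, 121, 322, 341, 261, 141, 221, 242, 362, 161, 371, 172, 252, 332, 311, 112, 232,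
      211, 131, 251, 331, 312, 122, 321]
    (by decide +kernel)

theorem tour_slab_4_7 : Tour spaceGraph (box 4 7 2) {e | e ∈ slabEdges 4 7} :=
  tour_of_points 4 7 2 _
    [111, 132, 212, 422, 441, 242, 362, 152, 351, 471, 272, 462, 261, 451, 331, 352, 472, 262,
      452, 431, 412, 332, 122, 321, 131, 211, 232, 112, 311, 121, 322, 341, 142, 161, 241,
      361, 342, 222, 421, 442, 461, 271, 151, 231, 252, 172, 371, 251, 171, 372, 162, 141,
      221, 411, 432, 312]
    (by decide +kernel)

theorem tour_slab_5_7 : Tour spaceGraph (box 5 7 2) {e | e ∈ slabEdges 5 7} :=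
  tour_of_points 5 7 2 _
    [111, 231, 421, 541, 562, 352, 151, 271, 461, 442, 522, 321, 122, 141, 221, 341, 551, 471,
      272, 462, 252, 172, 362, 572, 371, 161, 241, 451, 261, 242, 452, 262, 472, 552, 571,
      361, 162, 372, 171, 251, 232, 112, 311, 431, 412, 222, 432, 512, 531, 411, 331, 211,
      131, 152, 351, 561, 441, 422, 542, 521, 322, 121, 142, 332, 212, 132, 342, 532, 511,
      312]
    (by decide +kernel)

theorem tour_column_4 : Tour spaceGraph (box 3 3 4) {e | e ∈ columnEdges 4} :=
  tour_of_points 3 3 4 _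
    [111, 123, 333, 314, 113, 134, 324, 222, 124, 132, 212, 332, 234, 114, 133, 323, 221, 213,
      311, 231, 223, 321, 122, 224, 232, 112, 131, 211, 331, 121, 322, 334, 313, 233, 214,
      312]
    (by decide +kernel)

theorem tour_column_6 : Tour spaceGraph (box 3 3 6) {e | e ∈ columnEdges 6} :=
  tour_of_points 3 3 6 _
    [111, 132, 212, 314, 234, 226, 214, 222, 324, 134, 113, 312, 122, 321, 131, 233, 221, 123,
      225, 213, 311, 332, 133, 323, 124, 116, 236, 224, 322, 121, 331, 211, 232, 112, 313,
      215, 223, 125, 326, 136, 335, 316, 115, 325, 126, 336, 315, 334, 135, 114, 216, 235,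
      333, 231]
    (by decide +kernel)

/-! ### Tours of slabs and columns -/

theorem tour_slab_add_three {x y : ℤ} (hx : 3 ≤ x) (hy : 4 ≤ y)
    (h : Tour spaceGraph (box x y 2) {e | e ∈ slabEdges x y})
    (h' : Tour spaceGraph (box 3 y 2) {e | e ∈ leftEdge :: slabEdges 3 y}) :
    Tour spaceGraph (box (x + 3) y 2) {e | e ∈ slabEdges (x + 3) y} := by
  refine h.glue spaceGraph_adj_add h' (x, 0, 0) (p := (x, 1, 2)) (q := (x, 3, 1))
    (r := (1, 3, 2)) (s := (1, 1, 1)) (by simp [slabEdges, rightEdge])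
    (by simp [leftEdge]) (by simp [spaceGraph_adj]) (by simp [spaceGraph_adj])
    (fun v => ?_) (fun v => ?_) (fun e he => ?_)
  · simp only [mem_box, Prod.fst_sub, Prod.snd_sub]
    omega
  · simp only [mem_box, Prod.fst_sub, Prod.snd_sub]
    omega
  · obtain rfl | he : e = rightEdge (x + 3) ∨ e ∈ backEdge y :: frontEdge :: coreEdges := by
      simpa [slabEdges] using he
    · exact .inr ⟨rightEdge 3, by simp [slabEdges], by simp [rightEdge],
        by simp [rightEdge, add_comm]⟩
    · refine .inl ⟨List.mem_cons_of_mem _ he, ?_⟩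
      rintro rfl
      simp [backEdge, frontEdge, coreEdges, upperEdge, lowerEdge, pairEdges] at he
      omega

theorem tour_slab_add_four {x y : ℤ} (hy : 4 ≤ y)
    (h : Tour spaceGraph (box x y 2) {e | e ∈ backEdge y :: coreEdges})
    (h' : Tour spaceGraph (box x 4 2) {e | e ∈ slabEdges x 4}) :
    Tour spaceGraph (box x (y + 4) 2) {e | e ∈ backEdge (y + 4) :: coreEdges} := by
  refine h.glue spaceGraph_adj_add h' (0, y, 0) (p := (3, y, 2)) (q := (1, y, 1))
    (r := (1, 1, 2)) (s := (3, 1, 1)) (by simp [backEdge])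
    (by simp [slabEdges, frontEdge]) (by simp [spaceGraph_adj]) (by simp [spaceGraph_adj])
    (fun v => ?_) (fun v => ?_) (fun e he => ?_)
  · simp only [mem_box, Prod.fst_sub, Prod.snd_sub]
    omega
  · simp only [mem_box, Prod.fst_sub, Prod.snd_sub]
    omega
  · obtain rfl | he : e = backEdge (y + 4) ∨ e ∈ coreEdges := by simpa using he
    · exact .inr ⟨backEdge 4, by simp [slabEdges], by simp [backEdge],
        by simp [backEdge, add_comm]⟩
    · refine .inl ⟨List.mem_cons_of_mem _ he, ?_⟩
      rintro rfl
      simp [coreEdges, upperEdge, lowerEdge, pairEdges] at he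
      omega

/-- All widths from `3` on are reached from the widths `3`, `4` and `5` by steps of `3`. -/
theorem tour_slab_of_width {y : ℤ} (hy : 4 ≤ y)
    (h₃ : Tour spaceGraph (box 3 y 2) {e | e ∈ leftEdge :: slabEdges 3 y})
    (h₄ : Tour spaceGraph (box 4 y 2) {e | e ∈ slabEdges 4 y})
    (h₅ : Tour spaceGraph (box 5 y 2) {e | e ∈ slabEdges 5 y}) (x : ℤ) (hx : 3 ≤ x) :
    Tour spaceGraph (box x y 2) {e | e ∈ slabEdges x y} := by
  obtain rfl | rfl | rfl | hx' : x = 3 ∨ x = 4 ∨ x = 5 ∨ 6 ≤ x := by omega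
  · exact h₃.mono fun e he => List.mem_cons_of_mem _ he
  · exact h₄
  · exact h₅
  · simpa using tour_slab_add_three (by omega) hy
      (tour_slab_of_width hy h₃ h₄ h₅ (x - 3) (by omega)) h₃
termination_by x.toNat

theorem tour_slab (x y : ℤ) (hx : 3 ≤ x) (hy : 4 ≤ y) :
    Tour spaceGraph (box x y 2) {e | e ∈ backEdge y :: coreEdges} := by
  have hsub (y : ℤ) : {e | e ∈ backEdge y :: coreEdges} ⊆ {e | e ∈ slabEdges x y} := by
    intro e he
    simp only [slabEdges, Set.mem_ofPred_eq, List.mem_cons] at he ⊢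
    tauto
  have h₄ := tour_slab_of_width (by norm_num) tour_slab_3_4 tour_slab_4_4 tour_slab_5_4 x hx
  obtain rfl | rfl | rfl | rfl | hy' : y = 4 ∨ y = 5 ∨ y = 6 ∨ y = 7 ∨ 8 ≤ y := by omega
  · exact h₄.mono (hsub _)
  · exact (tour_slab_of_width (by norm_num) tour_slab_3_5 tour_slab_4_5 tour_slab_5_5 x hx).mono
      (hsub _)
  · exact (tour_slab_of_width (by norm_num) tour_slab_3_6 tour_slab_4_6 tour_slab_5_6 x hx).mono
      (hsub _)
  · exact (tour_slab_of_width (by norm_num) tour_slab_3_7 tour_slab_4_7 tour_slab_5_7 x hx).mono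
      (hsub _)
  · simpa using tour_slab_add_four (by omega) (tour_slab x (y - 4) hx (by omega)) h₄
termination_by y.toNat

theorem tour_stack_slabs (x y : ℤ) (hx : 3 ≤ x) (hy : 4 ≤ y) (m : ℕ) :
    Tour spaceGraph (box x y (2 * m + 2)) {e | e ∈ upperEdge (2 * m + 2) :: pairEdges} := by
  have h' : Tour spaceGraph (box x y 2) {e | e ∈ coreEdges} :=
    (tour_slab x y hx hy).mono fun e he => List.mem_cons_of_mem _ he
  induction m with
  | zero =>
    refine h'.mono fun e he => ?_
    simp only [coreEdges, Set.mem_ofPred_eq, List.mem_cons, Nat.cast_zero, mul_zero, zero_add]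
      at he ⊢
    tauto
  | succ m ih =>
    refine ih.glue spaceGraph_adj_add h' (0, 0, 2 * m + 2)
      (p := (1, 3, 2 * m + 2 - 1)) (q := (2, 1, 2 * m + 2 - 1))
      (r := (1, 4, 1)) (s := (2, 2, 1)) (by simp [upperEdge])
      (by simp [coreEdges, lowerEdge]) (by simp [spaceGraph_adj]; ring)
      (by simp [spaceGraph_adj]; ring) (fun v => ?_) (fun v => ?_) (fun e he => ?_)
    · simp only [mem_box, Prod.fst_sub, Prod.snd_sub]
      push_cast
      omega
    · simp only [mem_box, Prod.fst_sub, Prod.snd_sub]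
      omega
    · obtain rfl | he : e = upperEdge (2 * (m + 1 : ℕ) + 2) ∨ e ∈ pairEdges := by simpa using he
      · refine .inr ⟨upperEdge 2, by simp [coreEdges], by simp [upperEdge], ?_⟩
        simp only [upperEdge, Sym2.map_mk, Prod.mk_add_mk, add_zero]
        push_cast
        ring_nf
      · refine .inl ⟨List.mem_cons_of_mem _ he, ?_⟩
        rintro rfl
        simp [pairEdges] at he
        omega

theorem tour_column_add_four {z : ℤ} (hz : 4 ≤ z)
    (h : Tour spaceGraph (box 3 3 z) {e | e ∈ columnEdges z}) :
    Tour spaceGraph (box 3 3 (z + 4)) {e | e ∈ columnEdges (z + 4)} := by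
  refine h.glue spaceGraph_adj_add tour_column_4 (0, 0, z) (p := (3, 2, z)) (q := (1, 3, z))
    (r := (1, 2, 1)) (s := (3, 3, 1)) (by simp [columnEdges]) (by simp [columnEdges])
    (by simp [spaceGraph_adj]) (by simp [spaceGraph_adj])
    (fun v => ?_) (fun v => ?_) (fun e he => ?_)
  · simp only [mem_box, Prod.fst_sub, Prod.snd_sub]
    omega
  · simp only [mem_box, Prod.fst_sub, Prod.snd_sub]
    omega
  · obtain rfl | he : e = s((3, 2, z + 4), (1, 3, z + 4)) ∨
        e ∈ s((1, 2, 1), (3, 3, 1)) :: pairEdges := by simpa [columnEdges] using he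
    · exact .inr ⟨s((3, 2, 4), (1, 3, 4)), by simp [columnEdges], by simp, by simp [add_comm]⟩
    · refine .inl ⟨List.mem_cons_of_mem _ he, ?_⟩
      rintro rfl
      simp [pairEdges] at he

theorem tour_column (z : ℤ) (hz : 4 ≤ z) (hz' : Even z) :
    Tour spaceGraph (box 3 3 z) {e | e ∈ columnEdges z} := by
  obtain rfl | rfl | hz'' : z = 4 ∨ z = 6 ∨ 8 ≤ z := by obtain ⟨m, rfl⟩ := hz'; omega
  · exact tour_column_4
  · exact tour_column_6
  · simpa using tour_column_add_four (by omega)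
      (tour_column (z - 4) (by omega) (hz'.sub (by decide)))
termination_by z.toNat

/-- Up to the order of the coordinates, all boxes with a closed tour are of one of the two kinds
considered here. -/
theorem tour_box {a b c : ℤ} (hc : Even c)
    (h : 3 ≤ a ∧ 4 ≤ b ∧ 2 ≤ c ∨ a = 3 ∧ b = 3 ∧ 4 ≤ c) :
    Tour spaceGraph (box a b c) {e | e ∈ pairEdges} := by
  obtain ⟨ha, hb, hc'⟩ | ⟨rfl, rfl, hc'⟩ := h
  · obtain ⟨m, rfl⟩ : ∃ m : ℕ, c = 2 * m + 2 := by
      obtain ⟨d, rfl⟩ := hc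
      exact ⟨(d - 1).toNat, by omega⟩
    exact (tour_stack_slabs a b ha hb m).mono fun e he => List.mem_cons_of_mem _ he
  · exact (tour_column c hc' hc).mono fun e he =>
      List.mem_cons_of_mem _ (List.mem_cons_of_mem _ he)

/-! ### Knight moves in arbitrary dimension -/

variable {k : ℕ}

theorem mem_moves {c : Fin k → ℤ} {i j : Fin k} (hij : i ≠ j) (hi : c i = 1 ∨ c i = -1)
    (hj : c j = 2 ∨ c j = -2) (h : ∀ l, l ≠ i → l ≠ j → c l = 0) : c ∈ moves k := by
  have h₀ : (Finset.univ.filter fun l => c l = 0) = ({i, j} : Finset (Fin k))ᶜ := by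
    ext l
    simp only [Finset.mem_filter_univ, Finset.mem_compl, Finset.mem_insert, Finset.mem_singleton]
    grind
  have h₁ : (Finset.univ.filter fun l => c l = 1 ∨ c l = -1) = {i} := by
    ext l
    simp only [Finset.mem_filter_univ, Finset.mem_singleton]
    grind
  have h₂ : (Finset.univ.filter fun l => c l = 2 ∨ c l = -2) = {j} := by
    ext l
    simp only [Finset.mem_filter_univ, Finset.mem_singleton]
    grind
  refine ⟨?_, by rw [h₁, Finset.card_singleton], by rw [h₂, Finset.card_singleton]⟩
  have hcard := Finset.card_le_univ ({i, j} : Finset (Fin k))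
  rw [Finset.card_pair hij, Fintype.card_fin] at hcard
  rw [h₀, Finset.card_compl, Finset.card_pair hij, Fintype.card_fin]
  omega

theorem exists_two_of_mem_moves {c : Fin k → ℤ} (hc : c ∈ moves k) :
    ∃ j, c j = 2 ∨ c j = -2 := by
  obtain ⟨j, hj⟩ := Finset.card_pos.1 (hc.2.2 ▸ one_pos)
  exact ⟨j, (Finset.mem_filter.1 hj).2⟩

/-- The knight graph on all integer points of `k`-dimensional space. -/
def latticeGraph (k : ℕ) : SimpleGraph (Fin k → ℤ) where
  Adj a b := a - b ∈ moves k
  symm := ⟨fun a b h => by simpa using neg_mem_moves h⟩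
  loopless := ⟨fun a h => by simpa [moves] using h.2.1⟩

theorem latticeGraph_adj_add (a b t : Fin k → ℤ) (h : (latticeGraph k).Adj a b) :
    (latticeGraph k).Adj (a + t) (b + t) := by
  change a + t - (b + t) ∈ moves k
  rwa [add_sub_add_right_eq_sub]

/-- The points of the board with sides `n`, as a subset of `ℤ ^ k`. -/
def boardSet (n : Fin k → ℕ) : Set (Fin k → ℤ) := {a | ∀ i, 1 ≤ a i ∧ a i ≤ n i}

theorem mem_boardSet_update {n : Fin k → ℕ} {j : Fin k} {m : ℕ} {a : Fin k → ℤ} :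
    a ∈ boardSet (Function.update n j m) ↔
      (1 ≤ a j ∧ a j ≤ m) ∧ ∀ i, i ≠ j → 1 ≤ a i ∧ a i ≤ n i := by
  constructor
  · intro h
    exact ⟨by simpa using h j, fun i hi => by simpa [hi] using h i⟩
  · rintro ⟨h₁, h₂⟩ i
    by_cases hi : i = j
    · subst hi
      simpa using h₁
    · simpa [hi] using h₂ i hi

/-! ### Stacking copies of a board -/

/-- Two points which differ by `±2` in one coordinate, and agree in all others. -/
def IsDoubleStep (a b : Fin k → ℤ) : Prop :=
  ∃ i, (a i - b i = 2 ∨ a i - b i = -2) ∧ ∀ j, j ≠ i → a j = b j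

theorem IsDoubleStep.add_right {a b : Fin k → ℤ} (h : IsDoubleStep a b) (t : Fin k → ℤ) :
    IsDoubleStep (a + t) (b + t) := by
  obtain ⟨i, hi, h⟩ := h
  exact ⟨i, by simpa using hi, fun j hj => by simp [h j hj]⟩

/-- A double step inside a layer becomes a knight move when its ends are placed in successive
layers. -/
theorem IsDoubleStep.adj {a b : Fin k → ℤ} (h : IsDoubleStep a b) {j : Fin k} (hj : a j = b j)
    (m : ℤ) : (latticeGraph k).Adj (a + Pi.single j m) (b + Pi.single j (m + 1)) := by
  obtain ⟨i, hi, h⟩ := h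
  have hij : j ≠ i := by
    rintro rfl
    omega
  refine mem_moves hij (.inr ?_) (j := i) ?_ fun l hl hl' => ?_
  · simp [hj]
  · simpa [hij.symm] using hi
  · simp [hl, h l hl']

/-- Two edges such that the ends of the first are taken to the ends of the second by double
steps. -/
def AreParallel (e f : Sym2 (Fin k → ℤ)) : Prop :=
  ∃ p q p' q', e = s(p, q) ∧ f = s(p', q') ∧ IsDoubleStep p p' ∧ IsDoubleStep q q'

/-- A tour of a board with two disjoint pairs of parallel edges. One of the pairs serves to connect
copies of the tour in successive layers of a board with one more dimension. As the other pair is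
then still present in every layer, the construction can be repeated. -/
def HasPairedTour (n : Fin k → ℕ) : Prop :=
  ∃ e e' f f', AreParallel e e' ∧ AreParallel f f' ∧ [e, e', f, f'].Nodup ∧
    Tour (latticeGraph k) (boardSet n) {e, e', f, f'}

/-- The image of an edge `a` layers further in direction `j`. -/
def shift (j : Fin k) (a : ℤ) : Sym2 (Fin k → ℤ) → Sym2 (Fin k → ℤ) :=
  Sym2.map (· + Pi.single j a)

theorem shift_zero (j : Fin k) (e : Sym2 (Fin k → ℤ)) : shift j 0 e = e := by
  simp [shift]

theorem AreParallel.shift {e f : Sym2 (Fin k → ℤ)} (h : AreParallel e f) (j : Fin k) (a : ℤ) :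
    AreParallel (shift j a e) (shift j a f) := by
  obtain ⟨p, q, p', q', rfl, rfl, hp, hq⟩ := h
  exact ⟨_, _, _, _, rfl, rfl, hp.add_right _, hq.add_right _⟩

/-- Translates of edges of a tour of a single layer are equal only if the edges are equal and lie
in the same layer. -/
theorem shift_inj {n : Fin k → ℕ} {j : Fin k} (hj : n j = 1) {E : Set (Sym2 (Fin k → ℤ))}
    (h : Tour (latticeGraph k) (boardSet n) E) {e f : Sym2 (Fin k → ℤ)} (he : e ∈ E) (hf : f ∈ E)
    {a b : ℤ} : shift j a e = shift j b f ↔ e = f ∧ a = b := by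
  refine ⟨fun hab => ?_, by rintro ⟨rfl, rfl⟩; rfl⟩
  have hE (p : Fin k → ℤ) (hp : p ∈ boardSet n) : p j = 1 := by
    have := hp j
    rw [hj] at this
    omega
  obtain rfl : a = b := by
    induction e with | h p q =>
    induction f with | h r s =>
    have hp := hE p (h.left_mem he)
    have hr := hE r (h.left_mem hf)
    have hs := hE s (h.right_mem hf)
    obtain ⟨h₁, -⟩ | ⟨h₁, -⟩ := Sym2.eq_iff.1 hab
    · simpa [hp, hr] using congrFun h₁ j
    · simpa [hp, hs] using congrFun h₁ j
  exact ⟨Sym2.map.injective (add_left_injective _) hab, rfl⟩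

/-- A tour of a single layer with a pair `e`, `e'` of parallel edges gives a tour of `m + 1` layers.
The edge `e` in one layer is connected with `e'` in the next. -/
theorem tour_layers {n : Fin k → ℕ} {j : Fin k} (hj : n j = 1) {e e' f f' : Sym2 (Fin k → ℤ)}
    (hee : AreParallel e e') (hne : [e, e', f, f'].Nodup)
    (h : Tour (latticeGraph k) (boardSet n) {e, e', f, f'}) (m : ℕ) :
    Tour (latticeGraph k) (boardSet (Function.update n j (m + 1)))
      {shift j 0 f, shift j 0 f', shift j m f, shift j m f', shift j m e} := by
  have hn : Function.update n j 1 = n := by rw [← hj, Function.update_eq_self]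
  simp only [List.nodup_cons, List.mem_cons, List.not_mem_nil, or_false, not_or] at hne
  obtain ⟨⟨hee', hef, hef'⟩, ⟨hef₁, hef₁'⟩, hff, -⟩ := hne
  induction m with
  | zero =>
    simp only [Nat.cast_zero, zero_add, shift_zero, hn]
    refine h.mono fun g hg => ?_
    simp only [Set.mem_insert_iff, Set.mem_singleton_iff] at hg ⊢
    tauto
  | succ m ih =>
    obtain ⟨p, q, p', q', rfl, rfl, hp, hq⟩ := hee
    have hE (v : Fin k → ℤ) (hv : v ∈ boardSet n) : v j = 1 := by
      have := hv j
      rw [hj] at this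
      omega
    have hpj := hE p (h.left_mem (q := q) (by simp))
    have hqj := hE q (h.right_mem (p := p) (by simp))
    have hpj' := hE p' (h.left_mem (q := q') (by simp))
    have hqj' := hE q' (h.right_mem (p := p') (by simp))
    refine ih.glue latticeGraph_adj_add h (Pi.single j ((m + 1 : ℕ) : ℤ))
      (p := p + Pi.single j (m : ℤ)) (q := q + Pi.single j (m : ℤ)) (r := p') (s := q')
      (by simp [shift]) (by simp) ?_ ?_ ?_ ?_ ?_
    · simpa using hp.adj (hpj.trans hpj'.symm) m
    · simpa using hq.adj (hqj.trans hqj'.symm) m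
    · intro v
      rw [← hn]
      simp only [Function.update_idem, mem_boardSet_update]
      simp only [Pi.sub_apply, Pi.single_eq_same]
      have : (∀ i, i ≠ j → 1 ≤ v i - (Pi.single j ((m + 1 : ℕ) : ℤ) : Fin k → ℤ) i ∧
          v i - (Pi.single j ((m + 1 : ℕ) : ℤ) : Fin k → ℤ) i ≤ n i) ↔
          ∀ i, i ≠ j → 1 ≤ v i ∧ v i ≤ n i :=
        forall₂_congr fun i hi => by simp [hi]
      rw [this, ← or_and_right]
      refine and_congr_left fun _ => ?_
      push_cast
      omega
    · intro v hv hv'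
      have h₁ := (mem_boardSet_update.1 hv).1
      have h₂ := hE _ hv'
      simp only [Pi.sub_apply, Pi.single_eq_same] at h₂
      push_cast at h₁ h₂
      omega
    · intro g hg
      simp only [Set.mem_insert_iff, Set.mem_singleton_iff] at hg
      obtain rfl | rfl | rfl | rfl | rfl := hg
      · refine .inl ⟨by simp, fun heq => hef ?_⟩
        exact ((shift_inj hj h (by simp) (by simp)).1 heq).1.symm
      · refine .inl ⟨by simp, fun heq => hef' ?_⟩
        exact ((shift_inj hj h (by simp) (by simp)).1 heq).1.symm
      · exact .inr ⟨f, by simp, Ne.symm hef₁, rfl⟩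
      · exact .inr ⟨f', by simp, Ne.symm hef₁', rfl⟩
      · exact .inr ⟨s(p, q), by simp, hee', rfl⟩

theorem HasPairedTour.update {n : Fin k → ℕ} (h : HasPairedTour n) {j : Fin k} (hj : n j = 1)
    {m : ℕ} (hm : 2 ≤ m) : HasPairedTour (Function.update n j m) := by
  obtain ⟨e, e', f, f', hee, hff, hne, h⟩ := h
  obtain ⟨m, rfl⟩ : ∃ l, m = l + 1 := ⟨m - 1, by omega⟩
  refine ⟨shift j 0 f, shift j 0 f', shift j m f, shift j m f', hff.shift j 0, hff.shift j m, ?_,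
    (tour_layers hj hee hne h m).mono fun g hg => ?_⟩
  · have hff : f ≠ f' := by simp at hne; tauto
    have hm : (0 : ℤ) ≠ m := by norm_cast; omega
    have hf : f ∈ ({e, e', f, f'} : Set _) := by simp
    have hf' : f' ∈ ({e, e', f, f'} : Set _) := by simp
    simp [shift_inj hj h hf hf', shift_inj hj h hf hf, shift_inj hj h hf' hf',
      shift_inj hj h hf' hf, hff, hm]
  · simp only [Set.mem_insert_iff, Set.mem_singleton_iff] at hg ⊢
    tauto

/-! ### From space to arbitrary dimension -/

theorem knight_coordinates {u v w : ℤ} (h : u ^ 2 + v ^ 2 + w ^ 2 = 5) :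
    (u = 0 ∧ (v = 1 ∨ v = -1) ∧ (w = 2 ∨ w = -2)) ∨
    (u = 0 ∧ (v = 2 ∨ v = -2) ∧ (w = 1 ∨ w = -1)) ∨
    ((u = 1 ∨ u = -1) ∧ v = 0 ∧ (w = 2 ∨ w = -2)) ∨
    ((u = 2 ∨ u = -2) ∧ v = 0 ∧ (w = 1 ∨ w = -1)) ∨
    ((u = 1 ∨ u = -1) ∧ (v = 2 ∨ v = -2) ∧ w = 0) ∨
    ((u = 2 ∨ u = -2) ∧ (v = 1 ∨ v = -1) ∧ w = 0) := by
  have bound (x y : ℤ) (hy : 0 ≤ y) (hx : x ^ 2 + y = 5) : -2 ≤ x ∧ x ≤ 2 :=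
    ⟨by nlinarith, by nlinarith⟩
  obtain ⟨hu, hu'⟩ := bound u (v ^ 2 + w ^ 2) (by positivity) (by linarith)
  obtain ⟨hv, hv'⟩ := bound v (u ^ 2 + w ^ 2) (by positivity) (by linarith)
  obtain ⟨hw, hw'⟩ := bound w (u ^ 2 + v ^ 2) (by positivity) (by linarith)
  have key : ∀ u ∈ Finset.Icc (-2 : ℤ) 2, ∀ v ∈ Finset.Icc (-2 : ℤ) 2,
      ∀ w ∈ Finset.Icc (-2 : ℤ) 2, u ^ 2 + v ^ 2 + w ^ 2 = 5 →
        (u = 0 ∧ (v = 1 ∨ v = -1) ∧ (w = 2 ∨ w = -2)) ∨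
        (u = 0 ∧ (v = 2 ∨ v = -2) ∧ (w = 1 ∨ w = -1)) ∨
        ((u = 1 ∨ u = -1) ∧ v = 0 ∧ (w = 2 ∨ w = -2)) ∨
        ((u = 2 ∨ u = -2) ∧ v = 0 ∧ (w = 1 ∨ w = -1)) ∨
        ((u = 1 ∨ u = -1) ∧ (v = 2 ∨ v = -2) ∧ w = 0) ∨
        ((u = 2 ∨ u = -2) ∧ (v = 1 ∨ v = -1) ∧ w = 0) := by
    decide +kernel
  exact key u (by simp [hu, hu']) v (by simp [hv, hv']) w (by simp [hw, hw']) h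

/-- The embedding of space in `ℤ ^ k` along three given coordinates; all other coordinates are
`1`. -/
def embed (i₀ i₁ i₂ : Fin k) (v : ℤ × ℤ × ℤ) : Fin k → ℤ := fun j =>
  if j = i₀ then v.1 else if j = i₁ then v.2.1 else if j = i₂ then v.2.2 else 1

variable {i₀ i₁ i₂ : Fin k}

theorem embed_injective (h₀₁ : i₀ ≠ i₁) (h₀₂ : i₀ ≠ i₂) (h₁₂ : i₁ ≠ i₂) :
    Function.Injective (embed i₀ i₁ i₂) := by
  intro v w h
  have h₀ := congrFun h i₀
  have h₁ := congrFun h i₁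
  have h₂ := congrFun h i₂
  simp only [embed, if_true, h₀₁.symm, h₀₂.symm, h₁₂.symm, if_false] at h₀ h₁ h₂
  exact Prod.ext h₀ (Prod.ext h₁ h₂)

theorem embed_adj (h₀₁ : i₀ ≠ i₁) (h₀₂ : i₀ ≠ i₂) (h₁₂ : i₁ ≠ i₂)
    (v w : ℤ × ℤ × ℤ) (h : spaceGraph.Adj v w) :
    (latticeGraph k).Adj (embed i₀ i₁ i₂ v) (embed i₀ i₁ i₂ w) := by
  change embed i₀ i₁ i₂ v - embed i₀ i₁ i₂ w ∈ moves k
  have e₀ : (embed i₀ i₁ i₂ v - embed i₀ i₁ i₂ w) i₀ = v.1 - w.1 := by simp [embed]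
  have e₁ : (embed i₀ i₁ i₂ v - embed i₀ i₁ i₂ w) i₁ = v.2.1 - w.2.1 := by
    simp [embed, h₀₁.symm]
  have e₂ : (embed i₀ i₁ i₂ v - embed i₀ i₁ i₂ w) i₂ = v.2.2 - w.2.2 := by
    simp [embed, h₀₂.symm, h₁₂.symm]
  have e₃ (l : Fin k) (hl₀ : l ≠ i₀) (hl₁ : l ≠ i₁) (hl₂ : l ≠ i₂) :
      (embed i₀ i₁ i₂ v - embed i₀ i₁ i₂ w) l = 0 := by simp [embed, hl₀, hl₁, hl₂]
  generalize embed i₀ i₁ i₂ v - embed i₀ i₁ i₂ w = c at *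
  rcases knight_coordinates h with h | h | h | h | h | h
  · exact mem_moves (i := i₁) (j := i₂) h₁₂ (by omega) (by omega) (by grind)
  · exact mem_moves (i := i₂) (j := i₁) h₁₂.symm (by omega) (by omega) (by grind)
  · exact mem_moves (i := i₀) (j := i₂) h₀₂ (by omega) (by omega) (by grind)
  · exact mem_moves (i := i₂) (j := i₀) h₀₂.symm (by omega) (by omega) (by grind)
  · exact mem_moves (i := i₀) (j := i₁) h₀₁ (by omega) (by omega) (by grind)
  · exact mem_moves (i := i₁) (j := i₀) h₀₁.symm (by omega) (by omega) (by grind)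

theorem image_embed_box {n : Fin k → ℕ} (hn : ∀ j, j ≠ i₀ → j ≠ i₁ → j ≠ i₂ → n j = 1) :
    embed i₀ i₁ i₂ '' box (n i₀) (n i₁) (n i₂) = boardSet n := by
  ext a
  constructor
  · rintro ⟨v, ⟨hv₀, hv₁, hv₂⟩, rfl⟩ j
    unfold embed
    split_ifs with hj₀ hj₁ hj₂
    · exact hj₀ ▸ hv₀
    · exact hj₁ ▸ hv₁
    · exact hj₂ ▸ hv₂
    · simp [hn j hj₀ hj₁ hj₂]
  · intro ha
    refine ⟨(a i₀, a i₁, a i₂), ⟨ha i₀, ha i₁, ha i₂⟩, funext fun j => ?_⟩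
    unfold embed
    split_ifs with hj₀ hj₁ hj₂
    · rw [hj₀]
    · rw [hj₁]
    · rw [hj₂]
    · have := ha j
      rw [hn j hj₀ hj₁ hj₂] at this
      omega

theorem hasPairedTour_of_space (h₀₁ : i₀ ≠ i₁) (h₀₂ : i₀ ≠ i₂) (h₁₂ : i₁ ≠ i₂)
    {n : Fin k → ℕ}
    (hn : ∀ j, j ≠ i₀ → j ≠ i₁ → j ≠ i₂ → n j = 1)
    (h : Tour spaceGraph (box (n i₀) (n i₁) (n i₂)) {e | e ∈ pairEdges}) : HasPairedTour n := by
  have hinj := embed_injective h₀₁ h₀₂ h₁₂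
  have key := h.map _ hinj (embed_adj h₀₁ h₀₂ h₁₂)
  rw [image_embed_box hn] at key
  have step (x y z : ℤ) (b : ℤ) (hb : y - b = 2 ∨ y - b = -2) :
      IsDoubleStep (embed i₀ i₁ i₂ (x, y, z)) (embed i₀ i₁ i₂ (x, b, z)) :=
    ⟨i₁, by simpa [embed, h₀₁.symm] using hb, fun j hj => by simp [embed, hj]⟩
  have step' (x y z : ℤ) (a : ℤ) (ha : x - a = 2 ∨ x - a = -2) :
      IsDoubleStep (embed i₀ i₁ i₂ (x, y, z)) (embed i₀ i₁ i₂ (a, y, z)) :=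
    ⟨i₀, by simpa [embed] using ha, fun j hj => by simp [embed, hj]⟩
  refine ⟨Sym2.map (embed i₀ i₁ i₂) s((1, 1, 2), (2, 3, 2)),
    Sym2.map (embed i₀ i₁ i₂) s((1, 3, 2), (2, 1, 2)),
    Sym2.map (embed i₀ i₁ i₂) s((1, 2, 1), (3, 2, 2)),
    Sym2.map (embed i₀ i₁ i₂) s((3, 2, 1), (1, 2, 2)),
    ⟨_, _, _, _, rfl, rfl, step _ _ _ _ (by norm_num), step _ _ _ _ (by norm_num)⟩,
    ⟨_, _, _, _, rfl, rfl, step' _ _ _ _ (by norm_num), step' _ _ _ _ (by norm_num)⟩,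
    ?_, key.mono ?_⟩
  · exact List.Nodup.map (f := Sym2.map (embed i₀ i₁ i₂)) (l := pairEdges)
      (Sym2.map.injective hinj) (by decide)
  · rintro e (rfl | rfl | rfl | rfl) <;> exact Set.mem_image_of_mem _ (by simp [pairEdges])

/-- The tour of a three-dimensional box is extended to the whole board by increasing the remaining
sides from `1` to their actual lengths one after the other. -/
theorem hasPairedTour_of_three (h₀₁ : i₀ ≠ i₁) (h₀₂ : i₀ ≠ i₂) (h₁₂ : i₁ ≠ i₂)
    {n : Fin k → ℕ} (hn : ∀ i, 2 ≤ n i) (heven : Even (n i₂))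
    (h : 3 ≤ n i₀ ∧ 4 ≤ n i₁ ∨ n i₀ = 3 ∧ n i₁ = 3 ∧ 4 ≤ n i₂) : HasPairedTour n := by
  have key (t : Finset (Fin k)) : HasPairedTour fun j =>
      if j ∈ ({i₀, i₁, i₂} : Finset (Fin k)) ∪ t then n j else 1 := by
    induction t using Finset.induction_on with
    | empty =>
      refine hasPairedTour_of_space h₀₁ h₀₂ h₁₂ (fun j hj₀ hj₁ hj₂ => by simp [hj₀, hj₁, hj₂]) ?_
      have := hn i₂
      simpa using tour_box (a := n i₀) (b := n i₁) (c := n i₂) (by exact_mod_cast heven)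
        (by omega)
    | insert j t _ ih =>
      by_cases hj : j ∈ ({i₀, i₁, i₂} : Finset (Fin k)) ∪ t
      · rwa [Finset.union_insert, Finset.insert_eq_of_mem hj]
      · convert ih.update (j := j) (by rw [if_neg hj]) (hn j) using 1
        funext l
        by_cases hl : l = j
        · subst hl
          simp
        · simp [hl]
  simpa using key Finset.univ

/-! ### From cyclic lists to Hamiltonian cycles -/

theorem length_pathEdges {V : Type*} (a : V) (l : List V) :
    (pathEdges (a :: l)).length = l.length := by
  induction l generalizing a with
  | nil => rfl
  | cons b l ih => simp [pathEdges, ih]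

theorem length_cycleEdges {V : Type*} (l : List V) : (cycleEdges l).length = l.length := by
  cases l with
  | nil => rfl
  | cons a l => simp [cycleEdges, length_pathEdges]

theorem exists_isHamiltonianCycle {V : Type*} [DecidableEq V] {G : SimpleGraph V} {l : List V}
    (hl : l.Nodup) (hmem : ∀ v, v ∈ l) (hadj : ∀ e ∈ cycleEdges l, e ∈ G.edgeSet)
    (hlen : 3 ≤ l.length) : ∃ (a : V) (p : G.Walk a a), p.IsHamiltonianCycle := by
  obtain _ | ⟨a, _ | ⟨b, l⟩⟩ := l
  · simp at hlen
  · simp at hlen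
  have hchain := isChain_of_pathEdges hadj
  obtain ⟨p, hp⟩ : ∃ p : G.Walk b a, p.support = b :: (l ++ [a]) := by
    refine ⟨(SimpleGraph.Walk.ofSupport (b :: (l ++ [a])) (by simp) hchain.of_cons).copy
      (by simp) (by simp), ?_⟩
    exact (SimpleGraph.Walk.support_copy ..).trans (SimpleGraph.Walk.support_ofSupport ..)
  have hab : G.Adj a b := hchain.rel
  have hperm : (b :: (l ++ [a])).Perm (a :: b :: l) := 
    List.perm_append_comm (l₁ := b :: l) (l₂ := [a])
  refine ⟨a, .cons hab p, ?_⟩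
  rw [SimpleGraph.Walk.isHamiltonianCycle_iff_isCycle_and_support_count_tail_eq_one,
    SimpleGraph.Walk.isCycle_iff_isPath_tail_and_le_length]
  refine ⟨⟨?_, ?_⟩, fun v => ?_⟩
  · simp only [SimpleGraph.Walk.getVert_cons_succ, SimpleGraph.Walk.tail_cons,
      SimpleGraph.Walk.isPath_copy]
    exact .mk' (by rw [hp]; exact hperm.nodup_iff.2 hl)
  · have h₁ := p.length_support
    rw [hp, hperm.length_eq] at h₁
    rw [SimpleGraph.Walk.length_cons, ← h₁]
    exact hlen
  · rw [SimpleGraph.Walk.support_cons, List.tail_cons, hp, hperm.count_eq]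
    exact List.count_eq_one_of_mem hl (hmem v)

theorem HasPairedTour.hasClosedTour {n : Fin k → ℕ} (h : HasPairedTour n) : HasClosedTour n := by
  obtain ⟨e, e', f, f', -, -, hne, l, h₁, h₂, h₃, h₄⟩ := h
  have hlen : 4 ≤ l.length := by
    rw [← length_cycleEdges]
    exact (hne.subperm fun g hg => h₄ g (by simpa using hg)).length_le
  lift l to List (Board n) using fun v hv => (h₂ v).1 hv
  refine exists_isHamiltonianCycle (l := l) (List.Nodup.of_map _ h₁) (fun v => ?_)
    (fun g hg => ?_) (by rw [List.length_map] at hlen; omega)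
  · obtain ⟨w, hw, hwv⟩ := List.mem_map.1 ((h₂ v.1).2 v.2)
    exact Subtype.ext hwv ▸ hw
  · have := h₃ (Sym2.map Subtype.val g) (by rw [cycleEdges_map]; exact List.mem_map_of_mem hg)
    induction g with
    | h v w => exact this

theorem HasClosedTour.connected {n : Fin k → ℕ} (h : HasClosedTour n) :
    (knightGraph n).Connected := by
  obtain ⟨a, p, hp⟩ := h
  have ha (b : Board n) : (knightGraph n).Reachable a b := ⟨p.takeUntil b (hp.mem_support b)⟩
  exact (SimpleGraph.connected_iff_exists_forall_reachable _).2 ⟨a, ha⟩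

/-! ### Obstructions to connectedness -/

/-- In a connected graph, a property shared by adjacent vertices is shared by all vertices. -/
theorem _root_.SimpleGraph.Connected.forall_of_adj {V : Type*} {G : SimpleGraph V} (hG : G.Connected)
    {P : V → Prop} (h : ∀ a b, G.Adj a b → P a → P b) (a b : V) (ha : P a) : P b := by
  obtain ⟨p⟩ := hG.preconnected a b
  induction p with
  | nil => exact ha
  | cons hadj _ ih => exact ih (h _ _ hadj ha)

theorem exists_four_le {n : Fin k → ℕ} (hk : 0 < k) (hn : ∀ i, 2 ≤ n i)
    (h : (knightGraph n).Connected) : ∃ i, 4 ≤ n i := by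
  by_contra! hlt
  -- The point `(2, …, 2)` would be isolated.
  have hn' (i : Fin k) : (2 : ℤ) ≤ n i := by exact_mod_cast hn i
  have key := h.forall_of_adj (P := fun a => ∀ i, a.1 i = 2) (fun a b hab ha => ?_)
    ⟨fun _ => 2, fun i => ⟨by norm_num, hn' i⟩⟩
    ⟨fun _ => 1, fun i => ⟨le_rfl, by linarith [hn' i]⟩⟩ fun _ => rfl
  · exact absurd (key ⟨0, hk⟩) (by norm_num)
  · obtain ⟨i, hi⟩ := exists_two_of_mem_moves hab
    have hb := b.2 i
    have := hlt i
    have := ha i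
    simp only [Pi.sub_apply] at hi
    omega

theorem exists_three_le {n : Fin k → ℕ} (hn : ∀ i, 2 ≤ n i)
    (h : (knightGraph n).Connected) (i : Fin k) : ∃ j, j ≠ i ∧ 3 ≤ n j := by
  by_contra! hlt
  -- Every move would have its entry `±2` in coordinate `i`, and so preserve the parity there.
  have hn' (i : Fin k) : (2 : ℤ) ≤ n i := by exact_mod_cast hn i
  have key := h.forall_of_adj (P := fun a => Even (a.1 i)) (fun a b hab ha => ?_)
    ⟨fun _ => 2, fun i => ⟨by norm_num, hn' i⟩⟩
    ⟨fun _ => 1, fun i => ⟨le_rfl, by linarith [hn' i]⟩⟩ even_two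
  · exact absurd key Int.not_even_one
  · obtain ⟨j, hj⟩ := exists_two_of_mem_moves hab
    simp only [Pi.sub_apply] at hj
    obtain rfl : j = i := by
      by_contra hji
      have := a.2 j
      have := b.2 j
      have := hlt j hji
      omega
    obtain ⟨c, hc⟩ := ha
    rcases hj with hj | hj
    · exact ⟨c - 1, by omega⟩
    · exact ⟨c + 1, by omega⟩

/-! ### Choosing three coordinates -/

theorem exists_coordinates (hk : 3 ≤ k) {n : Fin k → ℕ} (hn : ∀ i, 2 ≤ n i)
    (heven : ∃ i, Even (n i)) (h : (knightGraph n).Connected) :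
    ∃ i₀ i₁ i₂ : Fin k, i₀ ≠ i₁ ∧ i₀ ≠ i₂ ∧ i₁ ≠ i₂ ∧ Even (n i₂) ∧
      (3 ≤ n i₀ ∧ 4 ≤ n i₁ ∨ n i₀ = 3 ∧ n i₁ = 3 ∧ 4 ≤ n i₂) := by
  obtain ⟨b, hb⟩ := exists_four_le (by omega) hn h
  obtain ⟨a, hab, ha⟩ := exists_three_le hn h b
  obtain ⟨c, hca, hcb⟩ : ∃ c, c ≠ a ∧ c ≠ b := by
    have hcard : ({a, b} : Finset (Fin k)).card < (Finset.univ : Finset (Fin k)).card := by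
      rw [Finset.card_univ, Fintype.card_fin]
      exact Finset.card_le_two.trans_lt hk
    obtain ⟨c, -, hc⟩ := Finset.exists_mem_notMem_of_card_lt_card hcard
    exact ⟨c, by simpa using hc⟩
  have hc := hn c
  have odd_of_ne {m : ℕ} (hm : Even m) : m ≠ 3 := by
    rintro rfl
    exact absurd hm (by decide)
  -- An even side other than `n a` and `n b` can serve as the last one. If instead `n a` or `n b` is
  -- even, it is at least `4`, and an odd `n c`, which is at least `3`, can take its place.
  by_cases hbe : Even (n b)
  · by_cases hce : Even (n c)
    · exact ⟨a, b, c, hab, hca.symm, hcb.symm, hce, .inl ⟨ha, hb⟩⟩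
    · have : n c ≠ 2 := fun h2 => hce (h2 ▸ even_two)
      by_cases ha' : n a = 3
      · by_cases hc' : n c = 3
        · exact ⟨a, c, b, hca.symm, hab, hcb, hbe, .inr ⟨ha', hc', hb⟩⟩
        · exact ⟨a, c, b, hca.symm, hab, hcb, hbe, .inl ⟨ha, by omega⟩⟩
      · exact ⟨c, a, b, hca, hcb, hab, hbe, .inl ⟨by omega, by omega⟩⟩
  · obtain ⟨e, he⟩ := heven
    have heb : e ≠ b := by
      rintro rfl
      exact hbe he
    by_cases hea : e = a
    · subst hea
      have := odd_of_ne he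
      by_cases hce : Even (n c)
      · exact ⟨e, b, c, hab, hca.symm, hcb.symm, hce, .inl ⟨ha, hb⟩⟩
      · have : n c ≠ 2 := fun h2 => hce (h2 ▸ even_two)
        exact ⟨c, b, e, hcb, hca, hab.symm, he, .inl ⟨by omega, hb⟩⟩
    · exact ⟨a, b, e, hab, Ne.symm hea, heb.symm, he, .inl ⟨ha, hb⟩⟩

end KnightTour

theorem corollary4p5 (k : ℕ) (hk : 3 ≤ k) (n : Fin k → ℕ) (hn : ∀ i, 2 ≤ n i)
    (heven : ∃ i, Even (n i)) :
    KnightTour.HasClosedTour n ↔ (KnightTour.knightGraph n).Connected := by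
  refine ⟨fun h => h.connected, fun h => ?_⟩
  obtain ⟨i₀, i₁, i₂, h₀₁, h₀₂, h₁₂, he, hs⟩ := KnightTour.exists_coordinates hk hn heven h
  exact (KnightTour.hasPairedTour_of_three h₀₁ h₀₂ h₁₂ hn he hs).hasClosedTour
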